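/- **Concurrent games.** A concurrent game structure $G$ consists of a finite set $S$ of states, a finite set $M$ of moves, nonempty sets $\Gamma_1(s),\Gamma_2(s)\subseteq M$ of available moves at each state $s$, and a probability distribution $\delta(s,a,b)$ on $S$ for all $s\in S$, $a,b\in M$. A player-$j$ selector $\xi$ assigns to each $s$ a distribution $\xi(s)$ on $M$ supported in $\Gamma_j(s)$; $\mathrm{Sel}_j(s)$ is the set of these distributions at $s$. A player-$j$ strategy assigns to each finite nonempty sequence of states ending in $s$ an element of $\mathrm{Sel}_j(s)$; $\overline\xi$ is the memoryless strategy that always plays the selector $\xi$. Strategies $\sigma,\tau$ of the players and an initial state $s$ determine a probability measure $\Pr_s^{\sigma,\tau}$ on infinite sequences of states, the two moves being drawn independently at each step. For $F\subseteq S$ let $\mathrm{Safe}(F)$ be the event that all states visited lie in $F$, and put $T=S\setminus F$, $$\langle\sigma\rangle(s)=\inf_\tau \Pr_s^{\sigma,\tau}(\mathrm{Safe}(F)),\qquad \mathrm{val}(s)=\sup_\sigma\langle\sigma\rangle(s),\qquad W_1=\{s\in S: \mathrm{val}(s)=1\}.$$ Assume that every state $s\in W_1\cup T$ is absorbing, i.e.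 $\delta(s,a,b)(s)=1$ for all $a\in\Gamma_1(s)$, $b\in\Gamma_2(s)$. **One-step operators.** For $v:S\to\mathbb R$, a state $s$ and distributions $p\in\mathrm{Sel}_1(s)$, $q\in\mathrm{Sel}_2(s)$, let $\mathrm{Pre}_{p,q}(v)(s)=\sum_{a,b,t}v(t)\,\delta(s,a,b)(t)\,p(a)\,q(b)$, $\mathrm{Pre}_{1:p}(v)(s)=\inf_{q}\mathrm{Pre}_{p,q}(v)(s)$ and $\mathrm{Pre}_1(v)(s)=\sup_p \mathrm{Pre}_{1:p}(v)(s)$. Let $\mathrm{OptSel}(v,s)=\{p\in\mathrm{Sel}_1(s):\mathrm{Pre}_{1:p}(v)(s)=\mathrm{Pre}_1(v)(s)\}$; for $p\in\mathrm{OptSel}(v,s)$ let $\mathrm{CountOpt}(v,s,p)$ be the set of $b\in\Gamma_2(s)$ with $\mathrm{Pre}_{p,b}(v)(s)=\mathrm{Pre}_1(v)(s)$ ($b$ standing for the point mass at $b$); and let $\mathrm{OC}(v,s)$ be the set of pairs $(\mathrm{supp}(p),\mathrm{CountOpt}(v,s,p))$ with $p\in\mathrm{OptSel}(v,s)$. **Turn-based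 reduction.** $\overline G_v$ is the turn-based stochastic game with player-1 states $s\in S$, player-2 states $(s,A,B)$ with $(A,B)\in \mathrm{OC}(v,s)$, and random states $(s,A,b)$ with $(A,B)\in \mathrm{OC}(v,s)$ and $b\in B$ for some $B$. Its edges are $s\to(s,A,B)$, $(s,A,B)\to(s,A,b)$ for $b\in B$, and $(s,A,b)\to t$ for $t\in\bigcup_{a\in A}\mathrm{supp}\,\delta(s,a,b)$. The owner of a player state chooses (possibly at random) the successor along an edge; from a random state the successor is uniform over the edges. Strategies may again depend on the whole sequence of states visited, and values are defined as above. $\overline F$ consists of the states of $\overline G_v$ whose first component ($s$ itself for a player-1 state $s$) lies in $F$. Let $\overline A(v)$ be the set of states of $\overline G_v$ at which the value of $\mathrm{Safe}(\overline F)$ is $1$. **The algorithm.** It starts with the selector $\gamma_0$ that plays all available moves uniformly at random at each state. In pass $i\ge 0$ let $v_i=\langle\overline\gamma_i\rangle$, $I=\{s\in S\setminus(W_1\cup T):\mathrm{Pre}_1(v_i)(s)>v_i(s)\}$ and $U=(\overline A(v_i)\cap S)\setminus W_1$. 1. (Local step) If $I\ne\emptyset$: $\gamma_{i+1}(s)$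 is some element of $\mathrm{OptSel}(v_i,s)$ for $s\in I$, and $\gamma_{i+1}(s)=\gamma_i(s)$ for $s\notin I$. 2. (Non-local step) If $I=\emptyset$ and $U\neq\emptyset$: choose a pure memoryless player-1 strategy $\overline\sigma$ in $\overline G_{v_i}$ that guarantees $\mathrm{Safe}(\overline F)$ with value $1$ from every state of $\overline A(v_i)$. For $s\in U$, $\gamma_{i+1}(s)$ is some $p\in\mathrm{OptSel}(v_i,s)$ with $\overline\sigma(s)=(s,\mathrm{supp}(p),\mathrm{CountOpt}(v_i,s,p))$, and $\gamma_{i+1}(s)=\gamma_i(s)$ for $s\notin U$. 3. If $I=U=\emptyset$: $\gamma_{i+1}=\gamma_i$ and the algorithm stops. **Theorem (Monotonicity of values).** Let $\gamma_i$ and $\gamma_{i+1}$ be the selectors at consecutive iterations $i$ and $i+1$ ($i\ge0$) of any run of this algorithm, whatever choices are made in the steps. If $\gamma_i\ne\gamma_{i+1}$, then (a) $\langle\overline\gamma_i\rangle(s)\le\langle\overline\gamma_{i+1}\rangle(s)$ for all $s\in S$; and (b) $\langle\overline\gamma_i\rangle(s^*)<\langle\overline\gamma_{i+1}\rangle(s^*)$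 for some $s^*\in S$. This covers both the local and the non-local steps. -/

import Mathlib

open scoped Classical
open MeasureTheory ProbabilityTheory

noncomputable section

namespace CSG

/-! ### Distributions, histories, laws of processes -/

/-- Probability distributions on a finite set. -/
abbrev Dist (A : Type*) [Fintype A] : Type _ := stdSimplex ℝ A

/-- The support of a distribution. -/
def Dist.supp {A : Type*} [Fintype A] (p : Dist A) : Finset A :=
  Finset.univ.filter (fun a => 0 < p a)

/-- The point mass at `a`. -/
def Dist.dirac {A : Type*} [Fintype A] (a : A) : Dist A :=
  ⟨Pi.single a 1, single_mem_stdSimplex ℝ a⟩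

/-- The uniform distribution on a nonempty finite set. -/
def Dist.uniformOn {A : Type*} [Fintype A] (B : Finset A) (hB : B.Nonempty) : Dist A :=
  ⟨fun a => if a ∈ B then (B.card : ℝ)⁻¹ else 0, by
    refine ⟨fun a => ?_, ?_⟩
    · dsimp only
      split_ifs <;> positivity
    · have : (B.card : ℝ) ≠ 0 := by exact_mod_cast hB.card_pos.ne'
      simp [Finset.sum_ite_mem, this]⟩

/-- A distribution seen as a measure. -/
def Dist.toMeasure {A : Type*} [Fintype A] [MeasurableSpace A] (p : Dist A) : Measure A :=
  ∑ a, ENNReal.ofReal (p a) • Measure.dirac a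

lemma Dist.isProbabilityMeasure_toMeasure {A : Type*} [Fintype A] [MeasurableSpace A]
    (p : Dist A) : IsProbabilityMeasure (Dist.toMeasure p) := by
  constructor
  simp only [Dist.toMeasure, Measure.coe_finsetSum, Finset.sum_apply, Measure.smul_apply,
    measure_univ, smul_eq_mul, mul_one]
  have h : ∑ a, p a = 1 := p.2.2
  rw [← ENNReal.ofReal_sum_of_nonneg (f := fun a => p a) (fun a _ => p.2.1 a)]
  rw [h, ENNReal.ofReal_one]

/-- The finite sequences `x₀, …, xₙ`. -/
abbrev History (X : Type*) (n : ℕ) := (i : Finset.Iic n) → X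

/-- The last entry of a finite nonempty sequence. -/
def History.last {X : Type*} {n : ℕ} (h : History X n) : X := h ⟨n, Finset.mem_Iic.2 le_rfl⟩

/-- The kernels that give the law of the next state after a finite nonempty sequence of states. -/
def stepKernel {X : Type*} [Fintype X] [MeasurableSpace X] [DiscreteMeasurableSpace X]
    (next : (n : ℕ) → History X n → Dist X) (n : ℕ) :
    Kernel (History X n) X where
  toFun h := Dist.toMeasure (next n h)
  measurable' := Measurable.of_discrete

instance {X : Type*} [Fintype X] [MeasurableSpace X] [DiscreteMeasurableSpace X]
    (next : (n : ℕ) → History X n → Dist X) (n : ℕ) :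
    IsMarkovKernel (stepKernel next n) :=
  ⟨fun h => Dist.isProbabilityMeasure_toMeasure (next n h)⟩

/-- The law on infinite sequences of the process that starts in `x` and moves according to
`next`. -/
def law {X : Type*} [Fintype X] [MeasurableSpace X] [DiscreteMeasurableSpace X]
    (next : (n : ℕ) → History X n → Dist X) (x : X) : Measure (ℕ → X) :=
  Kernel.traj (X := fun _ => X) (stepKernel next) 0 (fun _ => x)

/-- The probability of an event for the process that starts in `x` and moves according to
`next`; the finite state space carries the discrete σ-algebra. -/
def processProb {X : Type*} [Fintype X]
    (next : (n : ℕ) → History X n → Dist X) (x : X) (Φ : Set (ℕ → X)) : ℝ :=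
  letI : MeasurableSpace X := ⊤
  (law next x).real Φ

/-- The safety objective: never leave `F`. -/
def Safe {X : Type*} (F : Set X) : Set (ℕ → X) := {ω | ∀ k, ω k ∈ F}

/-! ### Concurrent games -/

/-- A concurrent game structure with states `S` and moves `M`. -/
structure ConcurrentGame (S M : Type*) [Fintype S] where
  mov1 : S → Finset M
  mov2 : S → Finset M
  mov1_nonempty : ∀ s, (mov1 s).Nonempty
  mov2_nonempty : ∀ s, (mov2 s).Nonempty
  trans : S → M → M → Dist S

/-- The distributions over moves that only use moves from `A`. -/
abbrev LocalSel {M : Type*} [Fintype M] (A : Finset M) :=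
  {p : Dist M // ∀ a, 0 < p a → a ∈ A}

namespace ConcurrentGame

variable {S M : Type*} [Fintype S] [Fintype M]

/-- Both players' choices only lead back to `s`. -/
def IsAbsorbing (G : ConcurrentGame S M) (s : S) : Prop :=
  ∀ a ∈ G.mov1 s, ∀ b ∈ G.mov2 s, G.trans s a b s = 1

/-- Player-1 selectors at the state `s`. -/
abbrev Sel1 (G : ConcurrentGame S M) (s : S) := LocalSel (G.mov1 s)

/-- Player-2 selectors at the state `s`. -/
abbrev Sel2 (G : ConcurrentGame S M) (s : S) := LocalSel (G.mov2 s)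

/-- Player-1 selectors. -/
abbrev Selector1 (G : ConcurrentGame S M) := (s : S) → G.Sel1 s

/-- Player-1 strategies: after every finite nonempty sequence of states, a selector at its last
state. -/
abbrev Strategy1 (G : ConcurrentGame S M) := (n : ℕ) → (h : History S n) → G.Sel1 h.last

/-- Player-2 strategies. -/
abbrev Strategy2 (G : ConcurrentGame S M) := (n : ℕ) → (h : History S n) → G.Sel2 h.last

/-- The memoryless strategy that plays the selector `ξ` forever. -/
def memoryless (G : ConcurrentGame S M) (ξ : G.Selector1) : G.Strategy1 :=
  fun _ h => ξ h.last

/-- The law of the successor of `s` when the moves are drawn independently from `p` and `q`. -/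
def succDist (G : ConcurrentGame S M) (s : S) (p q : Dist M) : Dist S :=
  ⟨fun t => ∑ a, ∑ b, p a * q b * G.trans s a b t, by
    refine ⟨fun t => ?_, ?_⟩
    · exact Finset.sum_nonneg fun a _ => Finset.sum_nonneg fun b _ =>
        mul_nonneg (mul_nonneg (p.2.1 a) (q.2.1 b)) ((G.trans s a b).2.1 t)
    · have hp : ∑ a, p a = 1 := p.2.2
      have hq : ∑ b, q b = 1 := q.2.2
      have ht : ∀ a b, ∑ t, G.trans s a b t = 1 := fun a b => (G.trans s a b).2.2
      rw [Finset.sum_comm]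
      have : ∀ a, ∑ t, ∑ b, p a * q b * G.trans s a b t = p a := by
        intro a
        rw [Finset.sum_comm]
        simp_rw [← Finset.mul_sum, ht, mul_one]
        rw [← Finset.mul_sum, hq, mul_one]
      simp_rw [this, hp]⟩

/-- The probability of an event under a pair of strategies, from the state `s`. -/
def prob (G : ConcurrentGame S M) (σ : G.Strategy1) (τ : G.Strategy2) (s : S)
    (Φ : Set (ℕ → S)) : ℝ :=
  processProb (fun n h => G.succDist h.last (σ n h).1 (τ n h).1) s Φ

/-- The value that the player-1 strategy `σ` guarantees. -/
def valueOf (G : ConcurrentGame S M) (σ : G.Strategy1) (Φ : Set (ℕ → S)) (s : S) : ℝ :=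
  ⨅ τ : G.Strategy2, G.prob σ τ s Φ

/-- The value of the game for player 1. -/
def value (G : ConcurrentGame S M) (Φ : Set (ℕ → S)) (s : S) : ℝ :=
  ⨆ σ : G.Strategy1, ⨅ τ : G.Strategy2, G.prob σ τ s Φ

/-- The almost-sure winning states: those where the value of the safety game is 1. -/
def W1 (G : ConcurrentGame S M) (F : Set S) : Set S := {s | G.value (Safe F) s = 1}

/-! ### One-step operators -/

/-- The expectation of `v` at the successor of `s` when the players use `p` and `q`. -/
def pre (G : ConcurrentGame S M) (v : S → ℝ) (s : S) (p q : Dist M) : ℝ :=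
  ∑ a, ∑ b, ∑ t, v t * G.trans s a b t * p a * q b

/-- The greatest expectation of `v` that `p` guarantees at the successor of `s`. -/
def preOf (G : ConcurrentGame S M) (v : S → ℝ) (s : S) (p : Dist M) : ℝ :=
  ⨅ q : G.Sel2 s, G.pre v s p q.1

/-- The greatest expectation of `v` that player 1 can guarantee at the successor of `s`. -/
def pre1 (G : ConcurrentGame S M) (v : S → ℝ) (s : S) : ℝ :=
  ⨆ p : G.Sel1 s, ⨅ q : G.Sel2 s, G.pre v s p.1 q.1

/-- The optimal selectors for `v` at `s`. -/
def OptSel (G : ConcurrentGame S M) (v : S → ℝ) (s : S) : Set (G.Sel1 s) :=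
  {p | G.preOf v s p.1 = G.pre1 v s}

/-- The counter-optimal moves against `p`. -/
def countOpt (G : ConcurrentGame S M) (v : S → ℝ) (s : S) (p : Dist M) : Finset M :=
  (G.mov2 s).filter (fun b => G.pre v s p (Dist.dirac b) = G.pre1 v s)

/-- The pairs of the support of an optimal selector and its set of counter-optimal moves. -/
def OptSelCount (G : ConcurrentGame S M) (v : S → ℝ) (s : S) : Set (Finset M × Finset M) :=
  {AB | ∃ p ∈ G.OptSel v s, Dist.supp p.1 = AB.1 ∧ G.countOpt v s p.1 = AB.2}

end ConcurrentGame

/-! ### Turn-based stochastic games -/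

/-- Who moves at a state. -/
inductive Owner
  | player1
  | player2
  | random

/-- A turn-based stochastic game on the finite graph with vertices `X` and edges `edge`; the
partition of `X` is given by `owner`. -/
structure TurnBasedGame (X : Type*) [Fintype X] where
  owner : X → Owner
  edge : X → X → Prop
  trans : (x : X) → owner x = .random → Dist X
  edge_iff : ∀ x (hx : owner x = .random) y, edge x y ↔ 0 < trans x hx y
  exists_edge : ∀ x, ∃ y, edge x y

namespace TurnBasedGame

variable {X : Type*} [Fintype X]

/-- The distributions over the successors of `x`. -/
abbrev SuccDist (G : TurnBasedGame X) (x : X) := {p : Dist X // ∀ y, 0 < p y → G.edge x y}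

/-- Player-1 strategies: defined on the finite sequences that end in a player-1 state. -/
abbrev Strategy1 (G : TurnBasedGame X) :=
  (n : ℕ) → (h : History X n) → G.owner h.last = .player1 → G.SuccDist h.last

/-- Player-2 strategies: defined on the finite sequences that end in a player-2 state. -/
abbrev Strategy2 (G : TurnBasedGame X) :=
  (n : ℕ) → (h : History X n) → G.owner h.last = .player2 → G.SuccDist h.last

/-- Pure memoryless player-1 strategies: a choice of an edge at every player-1 state. -/
abbrev Pure1 (G : TurnBasedGame X) :=
  (x : X) → G.owner x = .player1 → {y : X // G.edge x y}

/-- The strategy given by a choice of edges. -/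
def ofPure (G : TurnBasedGame X) (f : G.Pure1) : G.Strategy1 :=
  fun _ h hh => ⟨Dist.dirac (f h.last hh).1, by
    intro y hy
    have : y = (f h.last hh).1 := by
      by_contra hne
      have h0 : Dist.dirac (f h.last hh).1 y = 0 := Pi.single_eq_of_ne hne 1
      exact absurd hy (by rw [h0]; exact lt_irrefl _)
    rw [this]
    exact (f h.last hh).2⟩

/-- The law of the next state under a pair of strategies. -/
def next (G : TurnBasedGame X) (σ : G.Strategy1) (τ : G.Strategy2) (n : ℕ) (h : History X n) :
    Dist X :=
  match hk : G.owner h.last with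
  | .player1 => (σ n h hk).1
  | .player2 => (τ n h hk).1
  | .random => G.trans h.last hk

/-- The probability of an event under a pair of strategies, from the state `x`. -/
def prob (G : TurnBasedGame X) (σ : G.Strategy1) (τ : G.Strategy2) (x : X)
    (Φ : Set (ℕ → X)) : ℝ :=
  processProb (G.next σ τ) x Φ

/-- The value that the player-1 strategy `σ` guarantees. -/
def valueOf (G : TurnBasedGame X) (σ : G.Strategy1) (Φ : Set (ℕ → X)) (x : X) : ℝ :=
  ⨅ τ : G.Strategy2, G.prob σ τ x Φ

/-- The value of the game for player 1. -/
def value (G : TurnBasedGame X) (Φ : Set (ℕ → X)) (x : X) : ℝ :=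
  ⨆ σ : G.Strategy1, ⨅ τ : G.Strategy2, G.prob σ τ x Φ

/-- The almost-sure winning states: those where the value of the safety game is 1. -/
def W1 (G : TurnBasedGame X) (F : Set X) : Set X := {x | G.value (Safe F) x = 1}

end TurnBasedGame

/-! ### The turn-based reduction -/

namespace ConcurrentGame

variable {S M : Type*} [Fintype S] [Fintype M]

/-- The states of the turn-based reduction: the states of the game, the triples `(s, A, B)` and
the triples `(s, A, b)`. -/
inductive TBState (G : ConcurrentGame S M) (v : S → ℝ) : Type _
  | base (s : S) : TBState G v
  | pair (s : S) (A B : Finset M) (h : (A, B) ∈ G.OptSelCount v s) : TBState G v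
  | rand (s : S) (A : Finset M) (b : M) (h : ∃ B, (A, B) ∈ G.OptSelCount v s ∧ b ∈ B) :
      TBState G v

/-- Forgetting the proofs. -/
def TBState.code {G : ConcurrentGame S M} {v : S → ℝ} :
    G.TBState v → S ⊕ (S × Finset M × Finset M) ⊕ (S × Finset M × M)
  | .base s => .inl s
  | .pair s A B _ => .inr (.inl (s, A, B))
  | .rand s A b _ => .inr (.inr (s, A, b))

lemma TBState.code_injective {G : ConcurrentGame S M} {v : S → ℝ} :
    Function.Injective (TBState.code (G := G) (v := v)) := by
  intro x y h
  cases x <;> cases y <;> simp_all [TBState.code]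

instance (G : ConcurrentGame S M) (v : S → ℝ) : Fintype (G.TBState v) :=
  Fintype.ofInjective _ TBState.code_injective

/-- The state of the game that a state of the reduction belongs to. -/
def TBState.origin {G : ConcurrentGame S M} {v : S → ℝ} : G.TBState v → S
  | .base s => s
  | .pair s _ _ _ => s
  | .rand s _ _ _ => s

/-- The possible successors of `s` when player 1 uses a move of `A` and player 2 uses `b`. -/
def destSet (G : ConcurrentGame S M) (s : S) (A : Finset M) (b : M) : Finset S :=
  A.biUnion (fun a => Dist.supp (G.trans s a b))

/-- The edges of the reduction. -/
def tbEdge (G : ConcurrentGame S M) (v : S → ℝ) : G.TBState v → G.TBState v → Prop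
  | .base s, .pair s' _ _ _ => s' = s
  | .pair s A B _, .rand s' A' b _ => s' = s ∧ A' = A ∧ b ∈ B
  | .rand s A b _, .base t => t ∈ G.destSet s A b
  | _, _ => False

/-- The owners in the reduction. -/
def tbOwner (G : ConcurrentGame S M) (v : S → ℝ) : G.TBState v → Owner
  | .base _ => .player1
  | .pair _ _ _ _ => .player2
  | .rand _ _ _ _ => .random

/-- The successors of a state of the reduction. -/
def tbSucc (G : ConcurrentGame S M) (v : S → ℝ) (x : G.TBState v) : Finset (G.TBState v) :=
  Finset.univ.filter (fun y => G.tbEdge v x y)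

lemma supp_nonempty {A : Type*} [Fintype A] (p : Dist A) : (Dist.supp p).Nonempty := by
  by_contra h
  rw [Finset.not_nonempty_iff_eq_empty] at h
  have h0 : ∀ a, p a = 0 := by
    intro a
    by_contra hne
    have : a ∈ Dist.supp p := by
      simp only [Dist.supp, Finset.mem_filter, Finset.mem_univ, true_and]
      exact lt_of_le_of_ne (p.2.1 a) (Ne.symm hne)
    simp [h] at this
  have h1 : ∑ a, p a = 1 := p.2.2
  simp [h0] at h1

/-- The point mass at an available move. -/
def pureSel {B : Finset M} {b : M} (hb : b ∈ B) : LocalSel B :=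
  ⟨Dist.dirac b, by
    intro y hy
    have : y = b := by
      by_contra hne
      have h0 : Dist.dirac b y = 0 := Pi.single_eq_of_ne hne 1
      exact absurd hy (by rw [h0]; exact lt_irrefl _)
    rwa [this]⟩

lemma pre_eq_sum_dirac (G : ConcurrentGame S M) (v : S → ℝ) (s : S) (p q : Dist M) :
    G.pre v s p q = ∑ b, q b * G.pre v s p (Dist.dirac b) := by
  have h : ∀ b, G.pre v s p (Dist.dirac b) = ∑ a, ∑ t, v t * G.trans s a b t * p a := by
    intro b
    unfold pre
    refine Finset.sum_congr rfl fun a _ => ?_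
    rw [Finset.sum_eq_single b]
    · refine Finset.sum_congr rfl fun t _ => ?_
      have : Dist.dirac b b = 1 := Pi.single_eq_same b 1
      rw [this, mul_one]
    · intro c _ hc
      refine Finset.sum_eq_zero fun t _ => ?_
      have : Dist.dirac b c = 0 := Pi.single_eq_of_ne hc 1
      rw [this, mul_zero]
    · simp
  simp_rw [h]
  unfold pre
  rw [Finset.sum_comm]
  refine Finset.sum_congr rfl fun b _ => ?_
  rw [Finset.mul_sum]
  refine Finset.sum_congr rfl fun a _ => ?_
  rw [Finset.mul_sum]
  exact Finset.sum_congr rfl fun t _ => by ring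

/-- Against `p`, some available move attains the infimum over all selectors. -/
lemma exists_move_eq_preOf (G : ConcurrentGame S M) (v : S → ℝ) (s : S) (p : Dist M) :
    ∃ b ∈ G.mov2 s, G.pre v s p (Dist.dirac b) = G.preOf v s p ∧
      ∀ q : G.Sel2 s, G.preOf v s p ≤ G.pre v s p q.1 := by
  obtain ⟨b, hb, hmin⟩ := (G.mov2 s).exists_min_image
    (fun b => G.pre v s p (Dist.dirac b)) (G.mov2_nonempty s)
  have hle : ∀ q : G.Sel2 s, G.pre v s p (Dist.dirac b) ≤ G.pre v s p q.1 := by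
    intro q
    rw [G.pre_eq_sum_dirac v s p q.1]
    have h1 : ∑ c, q.1 c = 1 := q.1.2.2
    calc G.pre v s p (Dist.dirac b) = ∑ c, q.1 c * G.pre v s p (Dist.dirac b) := by
          rw [← Finset.sum_mul, h1, one_mul]
      _ ≤ _ := by
          refine Finset.sum_le_sum fun c _ => ?_
          rcases (show (0 : ℝ) ≤ q.1 c from q.1.2.1 c).eq_or_lt with h0 | h0
          · rw [← h0]; simp
          · exact mul_le_mul_of_nonneg_left (hmin c (q.2 c h0)) h0.le
  have hbdd : BddBelow (Set.range fun q : G.Sel2 s => G.pre v s p q.1) :=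
    ⟨_, by rintro _ ⟨q, rfl⟩; exact hle q⟩
  have : Nonempty (G.Sel2 s) := ⟨pureSel hb⟩
  have heq : G.pre v s p (Dist.dirac b) = G.preOf v s p :=
    le_antisymm (le_ciInf hle) (ciInf_le hbdd (pureSel hb))
  exact ⟨b, hb, heq, fun q => heq ▸ hle q⟩

lemma exists_optSel (G : ConcurrentGame S M) (v : S → ℝ) (s : S) : (G.OptSel v s).Nonempty := by
  obtain ⟨a0, ha0⟩ := G.mov1_nonempty s
  have : Nonempty (G.Sel1 s) := ⟨pureSel ha0⟩
  have hclosed : IsClosed {p : Dist M | ∀ a, 0 < p a → a ∈ G.mov1 s} := by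
    have : {p : Dist M | ∀ a, 0 < p a → a ∈ G.mov1 s} =
        ⋂ a : M, ⋂ (_ : a ∉ G.mov1 s), {p : Dist M | (p.1 : M → ℝ) a ≤ 0} := by
      ext p
      simp only [Set.mem_ofPred_eq, Set.mem_iInter]
      exact ⟨fun h a ha => not_lt.1 fun h0 => ha (h a h0),
        fun h a h0 => by_contra fun ha => absurd h0 (not_lt.2 (h a ha))⟩
    rw [this]
    refine isClosed_iInter fun a => isClosed_iInter fun _ => isClosed_le ?_ continuous_const
    exact (continuous_apply a).comp continuous_subtype_val
  have : CompactSpace (G.Sel1 s) := isCompact_iff_compactSpace.1 hclosed.isCompact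
  have husc : UpperSemicontinuous (fun p : G.Sel1 s => ⨅ q : G.Sel2 s, G.pre v s p.1 q.1) := by
    refine upperSemicontinuous_ciInf (fun p => ?_) (fun q => Continuous.upperSemicontinuous ?_)
    · obtain ⟨_, _, _, h⟩ := G.exists_move_eq_preOf v s p.1
      exact ⟨_, by rintro _ ⟨q, rfl⟩; exact h q⟩
    · unfold pre
      refine continuous_finsetSum _ fun a _ => continuous_finsetSum _ fun b _ =>
        continuous_finsetSum _ fun t _ => ?_
      refine (continuous_const.mul ?_).mul continuous_const
      exact (continuous_apply a).comp (continuous_subtype_val.comp continuous_subtype_val)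
  obtain ⟨p, -, hp⟩ := (husc.upperSemicontinuousOn Set.univ).exists_isMaxOn
    Set.univ_nonempty isCompact_univ
  refine ⟨p, le_antisymm ?_ ?_⟩
  · exact le_ciSup (f := fun p : G.Sel1 s => ⨅ q : G.Sel2 s, G.pre v s p.1 q.1)
      ⟨_, by rintro _ ⟨p', rfl⟩; exact hp (Set.mem_univ p')⟩ p
  · exact ciSup_le fun p' => hp (Set.mem_univ p')

lemma tb_exists_edge (G : ConcurrentGame S M) (v : S → ℝ) (x : G.TBState v) :
    ∃ y, G.tbEdge v x y := by
  cases x with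
  | base s =>
    obtain ⟨p, hp⟩ := G.exists_optSel v s
    exact ⟨.pair s (Dist.supp p.1) (G.countOpt v s p.1) ⟨p, hp, rfl, rfl⟩, rfl⟩
  | pair s A B h =>
    obtain ⟨p, hp, hA, hB⟩ := h
    obtain ⟨b, hb, heq, -⟩ := G.exists_move_eq_preOf v s p.1
    have hbB : b ∈ B := by
      rw [← show G.countOpt v s p.1 = B from hB, countOpt, Finset.mem_filter]
      exact ⟨hb, heq.trans hp⟩
    exact ⟨.rand s A b ⟨B, ⟨p, hp, hA, hB⟩, hbB⟩, rfl, rfl, hbB⟩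
  | rand s A b h =>
    obtain ⟨B, ⟨p, -, hA, -⟩, -⟩ := h
    obtain ⟨a, ha⟩ := supp_nonempty p.1
    obtain ⟨t, ht⟩ := supp_nonempty (G.trans s a b)
    exact ⟨.base t, Finset.mem_biUnion.2 ⟨a, (show Dist.supp p.1 = A from hA) ▸ ha, ht⟩⟩

/-- The turn-based reduction of the game for the valuation `v`: from `(s, A, b)` the successor is
uniform over the possible successors. -/
def turnBased (G : ConcurrentGame S M) (v : S → ℝ) : TurnBasedGame (G.TBState v) where
  owner := G.tbOwner v
  edge := G.tbEdge v
  trans x _ := Dist.uniformOn (G.tbSucc v x) (by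
    obtain ⟨y, hy⟩ := G.tb_exists_edge v x
    exact ⟨y, by simpa [tbSucc] using hy⟩)
  edge_iff x hx y := by
    have hne : (G.tbSucc v x).Nonempty := by
      obtain ⟨y, hy⟩ := G.tb_exists_edge v x
      exact ⟨y, by simpa [tbSucc] using hy⟩
    have hpos : (0 : ℝ) < ((G.tbSucc v x).card : ℝ)⁻¹ := by
      have := hne.card_pos
      positivity
    change _ ↔ 0 < (if y ∈ G.tbSucc v x then ((G.tbSucc v x).card : ℝ)⁻¹ else 0)
    have hmem : y ∈ G.tbSucc v x ↔ G.tbEdge v x y := by simp [tbSucc]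
    rw [← hmem]
    split_ifs with h <;> simp [h, hpos]
  exists_edge := G.tb_exists_edge v

/-- The safe set of the reduction. -/
def tbSafe (G : ConcurrentGame S M) (v : S → ℝ) (F : Set S) : Set (G.TBState v) :=
  {x | x.origin ∈ F}

/-! ### The safety strategy-improvement algorithm -/

/-- The selector that plays all available moves uniformly at random. -/
def uniformSelector (G : ConcurrentGame S M) : G.Selector1 :=
  fun s => ⟨Dist.uniformOn (G.mov1 s) (G.mov1_nonempty s), by
    intro a ha
    by_contra hne
    have h0 : Dist.uniformOn (G.mov1 s) (G.mov1_nonempty s) a = 0 := if_neg hne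
    exact absurd ha (by rw [h0]; exact lt_irrefl _)⟩

/-- The safety value that the memoryless strategy of `γ` guarantees. -/
def safetyValue (G : ConcurrentGame S M) (F : Set S) (γ : G.Selector1) : S → ℝ :=
  G.valueOf (G.memoryless γ) (Safe F)

/-- The set `I` of states where one step improves on the current valuation. -/
def improvable (G : ConcurrentGame S M) (F : Set S) (γ : G.Selector1) : Set S :=
  {s | s ∉ G.W1 F ∪ Fᶜ ∧
    G.safetyValue F γ s < G.pre1 (G.safetyValue F γ) s}

/-- The set `U` of states outside `W1` that are almost-sure winning in the turn-based reduction
for the current valuation. -/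
def nonlocalSet (G : ConcurrentGame S M) (F : Set S) (γ : G.Selector1) : Set S :=
  {s | TBState.base s ∈ (G.turnBased (G.safetyValue F γ)).W1 (G.tbSafe (G.safetyValue F γ) F)}
    \ G.W1 F

/-- The improvement step based on `pre1`, taken when `I` is nonempty. -/
def LocalStep (G : ConcurrentGame S M) (F : Set S) (γ γ' : G.Selector1) : Prop :=
  (G.improvable F γ).Nonempty ∧
  ∃ ξ : G.Selector1,
    (∀ s ∈ G.improvable F γ,
      G.preOf (G.safetyValue F γ) s (ξ s).1 = G.pre1 (G.safetyValue F γ) s) ∧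
    (∀ s ∈ G.improvable F γ, γ' s = ξ s) ∧
    (∀ s ∉ G.improvable F γ, γ' s = γ s)

/-- The improvement step based on the turn-based reduction, taken when `I` is empty and `U` is
not: the new selector at the states of `U` comes from a pure memoryless strategy `f` that is
almost-sure winning from all almost-sure winning states of the reduction. -/
def NonlocalStep (G : ConcurrentGame S M) (F : Set S) (γ γ' : G.Selector1) : Prop :=
  G.improvable F γ = ∅ ∧ (G.nonlocalSet F γ).Nonempty ∧
  ∃ f : (G.turnBased (G.safetyValue F γ)).Pure1,
    (∀ x ∈ (G.turnBased (G.safetyValue F γ)).W1 (G.tbSafe (G.safetyValue F γ) F),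
      (G.turnBased (G.safetyValue F γ)).valueOf ((G.turnBased (G.safetyValue F γ)).ofPure f)
        (Safe (G.tbSafe (G.safetyValue F γ) F)) x = 1) ∧
    (∀ s ∈ G.nonlocalSet F γ,
      γ' s ∈ G.OptSel (G.safetyValue F γ) s ∧
      ∃ h : (Dist.supp (γ' s).1, G.countOpt (G.safetyValue F γ) s (γ' s).1) ∈
          G.OptSelCount (G.safetyValue F γ) s,
        (f (.base s) rfl).1 = .pair s _ _ h) ∧
    (∀ s ∉ G.nonlocalSet F γ, γ' s = γ s)

/-- Both `I` and `U` are empty: the loop is left after this pass. -/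
def Terminal (G : ConcurrentGame S M) (F : Set S) (γ : G.Selector1) : Prop :=
  G.improvable F γ = ∅ ∧ G.nonlocalSet F γ = ∅

/-- One pass through the loop; a terminal pass leaves the selector unchanged. -/
def Pass (G : ConcurrentGame S M) (F : Set S) (γ γ' : G.Selector1) : Prop :=
  G.LocalStep F γ γ' ∨ G.NonlocalStep F γ γ' ∨ (G.Terminal F γ ∧ γ' = γ)

/-- `γ 0, …, γ n` are the selectors of the first `n` passes of a run of the algorithm. -/
structure IsRun (G : ConcurrentGame S M) (F : Set S) (γ : ℕ → G.Selector1) (n : ℕ) : Prop where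
  start : γ 0 = G.uniformSelector
  pass : ∀ i < n, G.Pass F (γ i) (γ (i + 1))
  not_terminal : ∀ i, i + 1 < n → ¬ G.Terminal F (γ i)

end ConcurrentGame

end CSG

end

noncomputable section

namespace CSG

/-! ### Finite-horizon laws and bounds on the probability of safety. -/

section Law

/-! Once player 1 commits to a selector `γ`, player 2 faces a finite Markov decision process, and
the safety value `v` of `γ` is the greatest valuation `u` with values in `[0, 1]`, zero off `F`,
that satisfies `u s ≤ preOf u s (γ s)` for `s ∈ F` (`safetyValue_le_preOf`, `le_safetyValue`). To
show that `γ'` improves on `γ`, it is thus enough to exhibit such a `u` for `γ'` with `v ≤ u` and `v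
< u` somewhere.

For a local step, `u` is `v` raised to `pre1 v` on the improvable states.

For a non-local step, let `Y` be the set of states of the game that are almost-sure winning in the
reduction, and put `u = v + ε (1 - v)` on `Y`, `u = v` elsewhere. At a state changed by the step, a
counter-optimal reply keeps the play in `Y`, where `u` is an affine increasing function of `v`, so
the inequality for `v` carries over. Any other reply already gives an expectation of `v` above `v s`
by a positive gap, and a small `ε` is absorbed by the smallest of these finitely many gaps. The
unchanged states of `Y` lie in `W1`, where absorption forces `v = 1` and hence `u = v`.

The characterisation of `v` comes from value iteration: the infimum over all strategies of player 2
equals the limit of the finite-horizon values (`Realizes.iInf_eq`). The same result for the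
reduction under a pure memoryless strategy shows that value `1` passes to every possible successor,
which is what keeps the play in `Y`. -/

lemma Dist.lintegral_toMeasure {A : Type*} [Fintype A] [MeasurableSpace A]
    [DiscreteMeasurableSpace A] (p : Dist A) (f : A → ENNReal) :
    ∫⁻ a, f a ∂(Dist.toMeasure p) = ∑ a, ENNReal.ofReal (p a) * f a := by
  simp only [Dist.toMeasure]
  rw [lintegral_finsetSum_measure]
  refine Finset.sum_congr rfl fun a _ => ?_
  rw [lintegral_smul_measure, lintegral_dirac, smul_eq_mul]

variable {X : Type*}

/-- Appending a state to a finite sequence. -/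
def History.snoc {n : ℕ} (h : History X n) (y : X) : History X (n + 1) :=
  fun i => if hi : i.1 ≤ n then h ⟨i.1, Finset.mem_Iic.2 hi⟩ else y

/-- The finite sequence never leaves `F`. -/
def History.Stays (F : Set X) {n : ℕ} (h : History X n) : Prop := ∀ i, h i ∈ F

lemma History.last_snoc {n : ℕ} (h : History X n) (y : X) : (h.snoc y).last = y := by
  simp [History.last, History.snoc]

lemma History.stays_snoc {F : Set X} {n : ℕ} (h : History X n) (y : X) :
    (h.snoc y).Stays F ↔ h.Stays F ∧ y ∈ F := by
  constructor
  · intro hs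
    refine ⟨fun i => ?_, ?_⟩
    · have hi := Finset.mem_Iic.1 i.2
      have := hs ⟨i.1, Finset.mem_Iic.2 (hi.trans n.le_succ)⟩
      simpa [History.snoc, hi] using this
    · simpa [History.snoc] using hs ⟨n + 1, Finset.mem_Iic.2 le_rfl⟩
  · rintro ⟨hs, hy⟩ i
    unfold History.snoc
    split_ifs
    · exact hs _
    · exact hy

/-- The reward `V` of the last state of a finite sequence that stays in `F`. -/
def History.reward (F : Set X) (V : X → ℝ) {n : ℕ} (h : History X n) : ENNReal :=
  if h.Stays F then ENNReal.ofReal (V h.last) else 0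

/-- The reward is lost as soon as the play leaves `F`, so only successors in `F` contribute; hence
the indicator. -/
lemma sum_ofReal_mul_reward_snoc [Fintype X] (F : Set X) (V : X → ℝ) (hV : ∀ y, 0 ≤ V y) (p : Dist X) {n : ℕ}
    (h : History X n) (hs : h.Stays F) :
    ∑ y, ENNReal.ofReal (p y) * (h.snoc y).reward F V =
      ENNReal.ofReal (∑ y, p y * F.indicator V y) := by
  rw [ENNReal.ofReal_sum_of_nonneg (f := fun y => p y * F.indicator V y) fun y _ =>
    mul_nonneg (p.2.1 y) (Set.indicator_nonneg (fun y _ => hV y) y)]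
  refine Finset.sum_congr rfl fun y _ => ?_
  rw [ENNReal.ofReal_mul (show 0 ≤ p y from p.2.1 y)]
  congr 1
  by_cases hy : y ∈ F
  · simp [History.reward, History.stays_snoc, hs, hy, History.last_snoc]
  · simp [History.reward, History.stays_snoc, hy]

variable [Fintype X] [MeasurableSpace X] [DiscreteMeasurableSpace X]

/-- Conditioning on the first `n` steps turns the last step into a finite sum. All later estimates
are inductions on the horizon through this identity. -/
lemma lintegral_partialTraj_succ (next : (n : ℕ) → History X n → Dist X) (x : X) (n : ℕ)
    (g : History X (n + 1) → ENNReal) :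
    ∫⁻ h : History X (n + 1), g h ∂(Kernel.partialTraj (X := fun _ => X) (stepKernel next) 0 (n + 1) (fun _ => x)) =
      ∫⁻ h : History X n, ∑ y, ENNReal.ofReal (next n h y) * g (h.snoc y)
        ∂(Kernel.partialTraj (X := fun _ => X) (stepKernel next) 0 n (fun _ => x)) := by
  have hm : Measurable g := Measurable.of_discrete
  have hg : Measurable fun a => g (IicProdIoc (X := fun _ => X) n (n + 1) a) :=
    hm.comp (by fun_prop)
  rw [Kernel.partialTraj_succ_of_le (Nat.zero_le n), Kernel.lintegral_map _ (by fun_prop) _ hm,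
    Kernel.lintegral_comp _ _ _ hg]
  refine lintegral_congr fun h => ?_
  have hgh : Measurable fun b => g (IicProdIoc (X := fun _ => X) n (n + 1) (h, b)) :=
    hg.comp measurable_prodMk_left
  rw [Kernel.lintegral_id_prod hg, Kernel.lintegral_map _ (by fun_prop) _ hgh]
  -- The gluing map of the trajectory kernels is `snoc`.
  have hsnoc : ∀ y : X, IicProdIoc (X := fun _ => X) n (n + 1) (h, MeasurableEquiv.piSingleton (X := fun _ => X) n y) =
      History.snoc h y := by
    intro y
    funext ⟨i, hi⟩
    by_cases hin : i ≤ n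
    · simp [IicProdIoc, History.snoc, hin]
    · obtain rfl : i = n + 1 := by have := Finset.mem_Iic.1 hi; omega
      simp [IicProdIoc, History.snoc]
      rfl
  simp_rw [hsnoc]
  exact Dist.lintegral_toMeasure (next n h) fun y => g (History.snoc h y)

lemma law_stays (next : (n : ℕ) → History X n → Dist X) (x : X) (F : Set X) (n : ℕ) :
    law next x {ω | ∀ k ≤ n, ω k ∈ F} =
      ∫⁻ h : History X n, h.reward F (fun _ => 1)
        ∂(Kernel.partialTraj (X := fun _ => X) (stepKernel next) 0 n (fun _ => x)) := by
  have h1 : ∀ h : History X n, h.reward F (fun _ => 1) =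
      Set.indicator {h : History X n | h.Stays F} 1 h := by
    intro h
    by_cases hs : h.Stays F <;> simp [History.reward, hs]
  simp_rw [h1]
  rw [lintegral_indicator_one (MeasurableSet.of_discrete),
    ← Kernel.traj_map_frestrictLe_apply, Measure.map_apply (by fun_prop) (MeasurableSet.of_discrete)]
  unfold law
  congr 1
  ext ω
  simp [History.Stays]

instance (next : (n : ℕ) → History X n → Dist X) (x : X) : IsProbabilityMeasure (law next x) := by
  unfold law; infer_instance

/-- Continuity from above: safety is the decreasing intersection of its finite-horizon versions. -/
lemma tendsto_law_stays (next : (n : ℕ) → History X n → Dist X) (x : X) (F : Set X) :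
    Filter.Tendsto (fun n => law next x {ω | ∀ k ≤ n, ω k ∈ F}) Filter.atTop
      (nhds (law next x (Safe F))) := by
  have : Safe F = ⋂ n, {ω : ℕ → X | ∀ k ≤ n, ω k ∈ F} := by
    ext ω
    simp only [Safe, Set.mem_ofPred_eq, Set.mem_iInter]
    exact ⟨fun h n k _ => h k, fun h k => h k k le_rfl⟩
  rw [this]
  refine tendsto_measure_iInter_atTop (fun n => ?_) (fun m n hmn ω h k hk => h k (hk.trans hmn))
    ⟨0, measure_ne_top _ _⟩
  have : {ω : ℕ → X | ∀ k ≤ n, ω k ∈ F} = ⋂ k, ⋂ (_ : k ≤ n), (fun ω => ω k) ⁻¹' F := by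
    ext; simp
  rw [this]
  exact (MeasurableSet.iInter fun k => MeasurableSet.iInter fun _ =>
    measurable_pi_apply (X := fun _ : ℕ => X) k
      (MeasurableSet.of_discrete (s := F))).nullMeasurableSet

lemma lintegral_reward_zero (next : (n : ℕ) → History X n → Dist X) (x : X) (F : Set X)
    (V : X → ℝ) :
    ∫⁻ h : History X 0, h.reward F V
        ∂(Kernel.partialTraj (X := fun _ => X) (stepKernel next) 0 0 (fun _ => x)) =
      if x ∈ F then ENNReal.ofReal (V x) else 0 := by
  rw [Kernel.partialTraj_self, Kernel.id_apply, lintegral_dirac]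
  simp [History.reward, History.Stays, History.last]

/-- A valuation that does not decrease in expectation is a lower bound for the safety
probability. -/
lemma le_law_safe (next : (n : ℕ) → History X n → Dist X) (x : X) (F : Set X) (u : X → ℝ)
    (h0 : ∀ y, 0 ≤ u y) (h1 : ∀ y, u y ≤ 1) (hF : ∀ y ∉ F, u y = 0)
    (hu : ∀ n (h : History X n), h.last ∈ F → u h.last ≤ ∑ y, next n h y * u y) :
    ENNReal.ofReal (u x) ≤ law next x (Safe F) := by
  refine ge_of_tendsto' (tendsto_law_stays next x F) fun n => ?_
  rw [law_stays]
  -- Submartingale argument: the expected reward `u` over the histories that stay in `F` does not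
  -- decrease with the horizon.
  have key : ENNReal.ofReal (u x) ≤ ∫⁻ h : History X n, h.reward F u
      ∂(Kernel.partialTraj (X := fun _ => X) (stepKernel next) 0 n (fun _ => x)) := by
    induction n with
    | zero =>
      rw [lintegral_reward_zero]
      split_ifs with hx
      · exact le_rfl
      · simp [hF x hx]
    | succ n ih =>
      refine ih.trans ?_
      rw [lintegral_partialTraj_succ]
      refine lintegral_mono fun h : History X n => ?_
      by_cases hs : h.Stays F
      · simp only []
        -- Since `u` vanishes off `F`, dropping the histories that leave `F` costs nothing.
        rw [sum_ofReal_mul_reward_snoc F u h0 _ h hs, History.reward, if_pos hs,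
          Set.indicator_eq_self.2 fun y hy => by_contra fun hyF => hy (hF y hyF)]
        exact ENNReal.ofReal_le_ofReal (hu n h (hs _))
      · simp [History.reward, hs]
  refine key.trans (lintegral_mono fun h : History X n => ?_)
  by_cases hs : h.Stays F
  · simpa [History.reward, hs] using h1 _
  · simp [History.reward, hs]

/-- A sequence of valuations that does not increase in expectation is an upper bound for the
safety probability. -/
lemma law_safe_le (next : (n : ℕ) → History X n → Dist X) (x : X) (F : Set X) (N : ℕ)
    (V : ℕ → X → ℝ) (h0 : ∀ n y, 0 ≤ V n y) (hN : ∀ y ∈ F, 1 ≤ V N y)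
    (hV : ∀ n < N, ∀ h : History X n, h.last ∈ F →
      ∑ y, next n h y * V (n + 1) y ≤ V n h.last) :
    law next x (Safe F) ≤ ENNReal.ofReal (V 0 x) := by
  have hsub : Safe F ⊆ {ω : ℕ → X | ∀ k ≤ N, ω k ∈ F} := fun ω h k _ => h k
  refine (measure_mono hsub).trans ?_
  rw [law_stays]
  -- Supermartingale argument. Dropping the histories that leave `F` only lowers the expectation, so
  -- `V` need not vanish off `F`.
  have key : ∀ n ≤ N, ∫⁻ h : History X n, h.reward F (V n)
      ∂(Kernel.partialTraj (X := fun _ => X) (stepKernel next) 0 n (fun _ => x)) ≤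
        ENNReal.ofReal (V 0 x) := by
    intro n hn
    induction n with
    | zero =>
      rw [lintegral_reward_zero]
      split_ifs
      · exact le_rfl
      · exact zero_le
    | succ n ih =>
      refine le_trans ?_ (ih (by omega))
      rw [lintegral_partialTraj_succ]
      refine lintegral_mono fun h : History X n => ?_
      by_cases hs : h.Stays F
      · simp only []
        rw [sum_ofReal_mul_reward_snoc F _ (h0 _) _ h hs, History.reward, if_pos hs]
        refine ENNReal.ofReal_le_ofReal (le_trans ?_ (hV n (by omega) h (hs _)))
        exact Finset.sum_le_sum fun y _ => mul_le_mul_of_nonneg_left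
          (Set.indicator_le_self' (fun y _ => h0 _ y) y) ((next n h).2.1 y)
      · simp [History.reward, History.stays_snoc, hs]
  refine le_trans (lintegral_mono fun h : History X N => ?_) (key N le_rfl)
  by_cases hs : h.Stays F
  · simpa [History.reward, hs] using hN h.last (hs _)
  · simp [History.reward, hs]

end Law

section SafetyProbability

variable {X : Type*} [Fintype X]

lemma processProb_nonneg (next : (n : ℕ) → History X n → Dist X) (x : X) (Φ : Set (ℕ → X)) :
    0 ≤ processProb next x Φ := by
  unfold processProb
  exact measureReal_nonneg

lemma processProb_le_one (next : (n : ℕ) → History X n → Dist X) (x : X) (Φ : Set (ℕ → X)) :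
    processProb next x Φ ≤ 1 := by
  let _ : MeasurableSpace X := ⊤
  exact measureReal_le_one (μ := law next x)

lemma le_processProb_safe (next : (n : ℕ) → History X n → Dist X) (x : X) (F : Set X) (u : X → ℝ)
    (h0 : ∀ y, 0 ≤ u y) (h1 : ∀ y, u y ≤ 1) (hF : ∀ y ∉ F, u y = 0)
    (hu : ∀ n (h : History X n), h.last ∈ F → u h.last ≤ ∑ y, next n h y * u y) :
    u x ≤ processProb next x (Safe F) := by
  let _ : MeasurableSpace X := ⊤
  exact (ENNReal.ofReal_le_iff_le_toReal (measure_ne_top _ _)).1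
    (le_law_safe next x F u h0 h1 hF hu)

lemma processProb_safe_le (next : (n : ℕ) → History X n → Dist X) (x : X) (F : Set X) (N : ℕ)
    (V : ℕ → X → ℝ) (h0 : ∀ n y, 0 ≤ V n y) (hN : ∀ y ∈ F, 1 ≤ V N y)
    (hV : ∀ n < N, ∀ h : History X n, h.last ∈ F →
      ∑ y, next n h y * V (n + 1) y ≤ V n h.last) :
    processProb next x (Safe F) ≤ V 0 x := by
  let _ : MeasurableSpace X := ⊤
  exact ENNReal.toReal_le_of_le_ofReal (h0 0 x) (law_safe_le next x F N V h0 hN hV)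

end SafetyProbability

/-! ### Safety values of Markov decision processes -/

section Decision

variable {X : Type*} [Fintype X]

/-- The least probability, over `n` steps, of staying in `F` when an adversary chooses the
distribution of the successor of `x` from `D x`. -/
def boundedSafety (D : X → Finset (Dist X)) (hD : ∀ x, (D x).Nonempty) (F : Set X) : ℕ → X → ℝ
  | 0, x => if x ∈ F then 1 else 0
  | n + 1, x => if x ∈ F then
      (D x).inf' (hD x) (fun d => ∑ y, d y * boundedSafety D hD F n y) else 0

lemma Dist.sum_mul_nonneg (d : Dist X) (u : X → ℝ) (hu : ∀ y, 0 ≤ u y) : 0 ≤ ∑ y, d y * u y :=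
  Finset.sum_nonneg fun y _ => mul_nonneg (d.2.1 y) (hu y)

lemma Dist.sum_mul_mono (d : Dist X) {u w : X → ℝ} (h : ∀ y, u y ≤ w y) :
    ∑ y, d y * u y ≤ ∑ y, d y * w y :=
  Finset.sum_le_sum fun y _ => mul_le_mul_of_nonneg_left (h y) (d.2.1 y)

lemma Dist.sum_mul_const (d : Dist X) (c : ℝ) : ∑ y, d y * c = c := by
  rw [← Finset.sum_mul, show ∑ y, d y = 1 from d.2.2, one_mul]

variable (D : X → Finset (Dist X)) (hD : ∀ x, (D x).Nonempty) (F : Set X)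

lemma boundedSafety_nonneg (n : ℕ) (x : X) : 0 ≤ boundedSafety D hD F n x := by
  induction n generalizing x with
  | zero => unfold boundedSafety; split_ifs <;> norm_num
  | succ n ih =>
    unfold boundedSafety
    split_ifs
    · exact Finset.le_inf' _ _ fun d _ => d.sum_mul_nonneg _ ih
    · exact le_rfl

lemma boundedSafety_of_notMem (n : ℕ) {x : X} (hx : x ∉ F) : boundedSafety D hD F n x = 0 := by
  cases n <;> simp [boundedSafety, hx]

lemma boundedSafety_succ_le (n : ℕ) (x : X) :
    boundedSafety D hD F (n + 1) x ≤ boundedSafety D hD F n x := by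
  induction n generalizing x with
  | zero =>
    by_cases hx : x ∈ F
    · obtain ⟨d, hd⟩ := hD x
      simp only [boundedSafety, hx, if_true]
      refine (Finset.inf'_le _ hd).trans ?_
      calc _ ≤ ∑ y, d y * (1 : ℝ) := d.sum_mul_mono fun y => by split_ifs <;> norm_num
        _ = 1 := d.sum_mul_const 1
    · simp [boundedSafety_of_notMem, hx]
  | succ n ih =>
    by_cases hx : x ∈ F
    · rw [boundedSafety, boundedSafety, if_pos hx, if_pos hx]
      refine Finset.le_inf' _ _ fun d hd => (Finset.inf'_le _ hd).trans (d.sum_mul_mono ih)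
    · simp [boundedSafety_of_notMem, hx]

lemma bddBelow_boundedSafety (x : X) : BddBelow (Set.range fun n => boundedSafety D hD F n x) :=
  ⟨0, by rintro _ ⟨n, rfl⟩; exact boundedSafety_nonneg D hD F n x⟩

/-- For a fixed action the inequality holds at every finite horizon and survives the limit, because
the sum over successors is finite. No exchange of limit and minimum over actions is needed. -/
lemma boundedSafety_iInf_le (x : X) (hx : x ∈ F) (d : Dist X) (hd : d ∈ D x) :
    ⨅ n, boundedSafety D hD F n x ≤ ∑ y, d y * ⨅ n, boundedSafety D hD F n y := by
  have hlim : ∀ y, Filter.Tendsto (fun n => boundedSafety D hD F n y) Filter.atTop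
      (nhds (⨅ n, boundedSafety D hD F n y)) := fun y =>
    tendsto_atTop_ciInf (antitone_nat_of_succ_le fun n => boundedSafety_succ_le D hD F n y)
      (bddBelow_boundedSafety D hD F y)
  refine ge_of_tendsto' (tendsto_finsetSum _ fun y _ => (hlim y).const_mul (d y)) fun n => ?_
  refine (ciInf_le (bddBelow_boundedSafety D hD F x) (n + 1)).trans ?_
  rw [boundedSafety, if_pos hx]
  exact Finset.inf'_le _ hd

/-- A family of processes that consists of the plays of a Markov decision process with actions
`D`, in the sense that every step is at least as good for a valuation as some action, and that
every choice of actions depending on time and the current state is one of the processes. -/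
structure Realizes {T : Type*} (next : T → (n : ℕ) → History X n → Dist X) : Prop where
  le : ∀ τ n (h : History X n) (w : X → ℝ) (c : ℝ), (∀ d ∈ D h.last, c ≤ ∑ y, d y * w y) →
    c ≤ ∑ y, next τ n h y * w y
  exists_eq : ∀ a : ℕ → X → Dist X, (∀ n x, a n x ∈ D x) →
    ∃ τ, ∀ n (h : History X n), next τ n h = a n h.last

variable {D F} {T : Type*} {next : T → (n : ℕ) → History X n → Dist X}

lemma bddBelow_processProb (next : T → (n : ℕ) → History X n → Dist X) (x : X)
    (Φ : Set (ℕ → X)) : BddBelow (Set.range fun τ => processProb (next τ) x Φ) :=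
  ⟨0, by rintro _ ⟨τ, rfl⟩; exact processProb_nonneg _ _ _⟩

lemma Realizes.nonempty (hD : ∀ x, (D x).Nonempty) (hr : Realizes D next) : Nonempty T := by
  obtain ⟨τ, -⟩ := hr.exists_eq (fun _ x => (hD x).choose) fun _ x => (hD x).choose_spec
  exact ⟨τ⟩

/-- Every valuation that the adversary cannot decrease is a lower bound for the safety value. -/
lemma Realizes.le_iInf (hD : ∀ x, (D x).Nonempty) (hr : Realizes D next) (u : X → ℝ)
    (h0 : ∀ y, 0 ≤ u y) (h1 : ∀ y, u y ≤ 1) (hF : ∀ y ∉ F, u y = 0)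
    (hu : ∀ x ∈ F, ∀ d ∈ D x, u x ≤ ∑ y, d y * u y) (x : X) :
    u x ≤ ⨅ τ, processProb (next τ) x (Safe F) := by
  have := Realizes.nonempty hD hr
  exact le_ciInf fun τ => le_processProb_safe _ x F u h0 h1 hF fun n h hh =>
    hr.le τ n h u _ (hu _ hh)

/-- For `≤`, the adversary plays optimally for a horizon `N`, and being safe forever is no likelier
than being safe for `N` steps. For `≥`, the limit of the finite-horizon values is itself a valuation
that the adversary cannot decrease. -/
lemma Realizes.iInf_eq (hD : ∀ x, (D x).Nonempty) (hr : Realizes D next) (x : X) :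
    ⨅ τ, processProb (next τ) x (Safe F) = ⨅ n, boundedSafety D hD F n x := by
  refine le_antisymm (le_ciInf fun N => ?_) ?_
  · have hmin : ∀ k x, ∃ d ∈ D x, x ∈ F →
        ∑ y, d y * boundedSafety D hD F k y = boundedSafety D hD F (k + 1) x := by
      intro k x
      obtain ⟨d, hd, he⟩ := Finset.exists_mem_eq_inf' (hD x)
        (fun d => ∑ y, d y * boundedSafety D hD F k y)
      exact ⟨d, hd, fun hx => by rw [boundedSafety, if_pos hx, he]⟩
    choose a ha hmin using hmin
    -- At time `n < N` there are `N - n` steps left, so the minimiser for a continuation of `N - (n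
    -- + 1)` steps is played. What happens from time `N` on is irrelevant.
    obtain ⟨τ, hτ⟩ := hr.exists_eq (fun n => a (N - (n + 1))) fun n => ha _
    refine (ciInf_le (bddBelow_processProb next x _) τ).trans ?_
    refine processProb_safe_le _ x F N (fun n => boundedSafety D hD F (N - n))
      (fun n => boundedSafety_nonneg D hD F _) (fun y hy => ?_) fun n hn h hh => ?_
    · simp [boundedSafety, hy]
    · rw [hτ, hmin _ _ hh, show N - (n + 1) + 1 = N - n by omega]
  · have hb := bddBelow_boundedSafety D hD F
    refine Realizes.le_iInf hD hr (fun x => ⨅ n, boundedSafety D hD F n x)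
      (fun y => le_ciInf fun n => boundedSafety_nonneg D hD F n y) (fun y => ?_) (fun y hy => ?_)
      (fun x hx d hd => boundedSafety_iInf_le D hD F x hx d hd) x
    · refine (ciInf_le (hb y) 0).trans ?_
      unfold boundedSafety
      split_ifs <;> norm_num
    · simp [boundedSafety_of_notMem, hy]

lemma Realizes.iInf_le_sum (hD : ∀ x, (D x).Nonempty) (hr : Realizes D next) (x : X) (hx : x ∈ F) (d : Dist X)
    (hd : d ∈ D x) :
    ⨅ τ, processProb (next τ) x (Safe F) ≤
      ∑ y, d y * ⨅ τ, processProb (next τ) y (Safe F) := by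
  simp_rw [Realizes.iInf_eq hD hr]
  exact boundedSafety_iInf_le D hD F x hx d hd

lemma Realizes.iInf_eq_zero (hD : ∀ x, (D x).Nonempty) (hr : Realizes D next) {x : X} (hx : x ∉ F) :
    ⨅ τ, processProb (next τ) x (Safe F) = 0 := by
  simp [Realizes.iInf_eq hD hr, boundedSafety_of_notMem, hx]

end Decision

section Decision

variable {X : Type*} [Fintype X] {D : X → Finset (Dist X)} {F : Set X} {T : Type*}
  {next : T → (n : ℕ) → History X n → Dist X}

lemma Dist.sum_dirac_mul (x : X) (u : X → ℝ) : ∑ y, Dist.dirac x y * u y = u x := by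
  rw [Finset.sum_eq_single x]
  · rw [show Dist.dirac x x = 1 from Pi.single_eq_same x 1, one_mul]
  · intro y _ hy
    rw [show Dist.dirac x y = 0 from Pi.single_eq_of_ne hy 1, zero_mul]
  · simp

lemma Dist.dirac_pos {x y : X} (h : 0 < Dist.dirac x y) : y = x := by
  by_contra hne
  rw [show Dist.dirac x y = 0 from Pi.single_eq_of_ne hne 1] at h
  exact lt_irrefl _ h

lemma Dist.dirac_self_pos (x : X) : 0 < Dist.dirac x x := by
  rw [show Dist.dirac x x = 1 from Pi.single_eq_same x 1]
  exact one_pos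

lemma Realizes.iInf_le_one (hD : ∀ x, (D x).Nonempty) (hr : Realizes D next) (x : X) :
    ⨅ τ, processProb (next τ) x (Safe F) ≤ 1 := by
  obtain ⟨τ⟩ := Realizes.nonempty hD hr
  exact (ciInf_le (bddBelow_processProb next x _) τ).trans (processProb_le_one _ _ _)

/-- Safety value `1` is inherited by all possible successors. -/
lemma Realizes.iInf_eq_one_of_pos (hD : ∀ x, (D x).Nonempty) (hr : Realizes D next) {x y : X}
    (hx : ⨅ τ, processProb (next τ) x (Safe F) = 1) {d : Dist X} (hd : d ∈ D x) (hy : 0 < d y) :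
    ⨅ τ, processProb (next τ) y (Safe F) = 1 := by
  have hxF : x ∈ F := by
    by_contra h
    rw [Realizes.iInf_eq_zero hD hr h] at hx
    exact zero_ne_one hx
  refine le_antisymm (Realizes.iInf_le_one hD hr y) (not_lt.1 fun hlt => ?_)
  have h1 := Realizes.iInf_le_sum hD hr x hxF d hd
  rw [hx] at h1
  refine absurd h1 (not_le.2 ?_)
  -- A successor of value below `1` and positive probability would pull the average strictly below
  -- `1`.
  calc ∑ z, d z * ⨅ τ, processProb (next τ) z (Safe F) < ∑ z, d z * (1 : ℝ) := by
        refine Finset.sum_lt_sum (fun z _ => mul_le_mul_of_nonneg_left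
          (Realizes.iInf_le_one hD hr z) (d.2.1 z)) ⟨y, Finset.mem_univ _, ?_⟩
        exact mul_lt_mul_of_pos_left hlt hy
    _ = 1 := d.sum_mul_const 1

end Decision

/-! ### Turn-based games under a pure memoryless strategy. -/

namespace TurnBasedGame

variable {X : Type*} [Fintype X] (G : TurnBasedGame X)

/-- The distributions of the successor that player 2 can choose purely against a pure memoryless
strategy of player 1. -/
def actions (f : G.Pure1) (x : X) : Finset (Dist X) :=
  match hk : G.owner x with
  | .player1 => {Dist.dirac (f x hk).1}
  | .player2 => (Finset.univ.filter (G.edge x)).image Dist.dirac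
  | .random => {G.trans x hk}

lemma actions_player1 (f : G.Pure1) {x : X} (hk : G.owner x = .player1) :
    G.actions f x = {Dist.dirac (f x hk).1} := by
  unfold actions
  split <;> rename_i heq <;> first | rfl | exact nomatch hk.symm.trans heq

lemma actions_player2 (f : G.Pure1) {x : X} (hk : G.owner x = .player2) :
    G.actions f x = (Finset.univ.filter (G.edge x)).image Dist.dirac := by
  unfold actions
  split <;> rename_i heq <;> first | rfl | exact nomatch hk.symm.trans heq

lemma actions_random (f : G.Pure1) {x : X} (hk : G.owner x = .random) :
    G.actions f x = {G.trans x hk} := by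
  unfold actions
  split <;> rename_i heq <;> first | rfl | exact nomatch hk.symm.trans heq

lemma actions_nonempty (f : G.Pure1) (x : X) : (G.actions f x).Nonempty := by
  cases hk : G.owner x
  · simp [G.actions_player1 f hk]
  · obtain ⟨y, hy⟩ := G.exists_edge x
    rw [G.actions_player2 f hk]
    exact ⟨_, Finset.mem_image_of_mem _ (Finset.mem_filter.2 ⟨Finset.mem_univ y, hy⟩)⟩
  · simp [G.actions_random f hk]

lemma next_player1 (σ : G.Strategy1) (τ : G.Strategy2) {n : ℕ} (h : History X n)
    (hk : G.owner h.last = .player1) : G.next σ τ n h = (σ n h hk).1 := by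
  unfold next
  split <;> rename_i heq <;> first | rfl | exact nomatch hk.symm.trans heq

lemma next_player2 (σ : G.Strategy1) (τ : G.Strategy2) {n : ℕ} (h : History X n)
    (hk : G.owner h.last = .player2) : G.next σ τ n h = (τ n h hk).1 := by
  unfold next
  split <;> rename_i heq <;> first | rfl | exact nomatch hk.symm.trans heq

lemma next_random (σ : G.Strategy1) (τ : G.Strategy2) {n : ℕ} (h : History X n)
    (hk : G.owner h.last = .random) : G.next σ τ n h = G.trans h.last hk := by
  unfold next
  split <;> rename_i heq <;> first | rfl | exact nomatch hk.symm.trans heq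

lemma realizes_actions (f : G.Pure1) :
    Realizes (G.actions f) (fun τ => G.next (G.ofPure f) τ) where
  le τ n h w c hc := by
    cases hk : G.owner h.last
    · rw [G.actions_player1 f hk] at hc
      rw [G.next_player1 _ _ h hk]
      exact hc _ (Finset.mem_singleton_self _)
    · rw [G.actions_player2 f hk] at hc
      -- A randomised choice of player 2 is an average of point masses; `c` is written as an average
      -- with the same weights to compare term by term.
      rw [G.next_player2 _ _ h hk, ← Dist.sum_mul_const (τ n h hk).1 c]
      refine Finset.sum_le_sum fun y _ => ?_
      rcases (show 0 ≤ (τ n h hk).1 y from (τ n h hk).1.2.1 y).eq_or_lt with h0 | h0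
      · rw [← h0]; simp
      · refine mul_le_mul_of_nonneg_left ?_ h0.le
        have := hc _ (Finset.mem_image_of_mem _
          (Finset.mem_filter.2 ⟨Finset.mem_univ y, (τ n h hk).2 y h0⟩))
        rwa [Dist.sum_dirac_mul] at this
    · rw [G.actions_random f hk] at hc
      rw [G.next_random _ _ h hk]
      exact hc _ (Finset.mem_singleton_self _)
  exists_eq a ha := by
    refine ⟨fun n h hk => ⟨a n h.last, fun y hy => ?_⟩, fun n h => ?_⟩
    · have := ha n h.last
      rw [G.actions_player2 f hk] at this
      obtain ⟨z, hz, hza⟩ := Finset.mem_image.1 this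
      rw [← hza] at hy
      rw [Dist.dirac_pos hy]
      exact (Finset.mem_filter.1 hz).2
    · have := ha n h.last
      cases hk : G.owner h.last
      · rw [G.actions_player1 f hk] at this
        rw [G.next_player1 _ _ h hk, Finset.mem_singleton.1 this]
        rfl
      · rw [G.next_player2 _ _ h hk]
      · rw [G.actions_random f hk] at this
        rw [G.next_random _ _ h hk, Finset.mem_singleton.1 this]

variable {G} {f : G.Pure1} {Φ : Set (ℕ → X)} {F : Set X}

lemma valueOf_le_one (σ : G.Strategy1) (x : X) : G.valueOf σ Φ x ≤ 1 := by
  have hne : Nonempty G.Strategy2 :=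
    ⟨fun _ h _ => ⟨Dist.dirac (G.exists_edge h.last).choose, fun y hy => by
      rw [Dist.dirac_pos hy]; exact (G.exists_edge h.last).choose_spec⟩⟩
  obtain ⟨τ⟩ := hne
  exact (ciInf_le (bddBelow_processProb (fun τ => G.next σ τ) x Φ) τ).trans
    (processProb_le_one _ _ _)

lemma mem_W1_of_valueOf_eq_one {σ : G.Strategy1} {x : X} (h : G.valueOf σ (Safe F) x = 1) :
    x ∈ G.W1 F := by
  have : Nonempty G.Strategy1 := ⟨σ⟩
  refine le_antisymm (ciSup_le fun σ => valueOf_le_one σ x) ?_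
  rw [← h]
  exact le_ciSup (f := fun σ => G.valueOf σ (Safe F) x)
    ⟨1, by rintro _ ⟨σ, rfl⟩; exact valueOf_le_one σ x⟩ σ

lemma valueOf_ofPure_eq_zero {x : X} (hx : x ∉ F) : G.valueOf (G.ofPure f) (Safe F) x = 0 :=
  Realizes.iInf_eq_zero (G.actions_nonempty f) (G.realizes_actions f) hx

lemma valueOf_ofPure_player1 {x : X} (hx : G.valueOf (G.ofPure f) (Safe F) x = 1)
    (hk : G.owner x = .player1) : G.valueOf (G.ofPure f) (Safe F) (f x hk).1 = 1 :=
  Realizes.iInf_eq_one_of_pos (G.actions_nonempty f) (G.realizes_actions f) hx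
    (by rw [G.actions_player1 f hk]; exact Finset.mem_singleton_self _) (Dist.dirac_self_pos _)

lemma valueOf_ofPure_player2 {x y : X} (hx : G.valueOf (G.ofPure f) (Safe F) x = 1)
    (hk : G.owner x = .player2) (hy : G.edge x y) :
    G.valueOf (G.ofPure f) (Safe F) y = 1 :=
  Realizes.iInf_eq_one_of_pos (G.actions_nonempty f) (G.realizes_actions f) hx
    (by
      rw [G.actions_player2 f hk]
      exact Finset.mem_image_of_mem _ (Finset.mem_filter.2 ⟨Finset.mem_univ y, hy⟩))
    (Dist.dirac_self_pos _)

lemma valueOf_ofPure_random {x y : X} (hx : G.valueOf (G.ofPure f) (Safe F) x = 1)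
    (hk : G.owner x = .random) (hy : G.edge x y) :
    G.valueOf (G.ofPure f) (Safe F) y = 1 :=
  Realizes.iInf_eq_one_of_pos (G.actions_nonempty f) (G.realizes_actions f) hx
    (by rw [G.actions_random f hk]; exact Finset.mem_singleton_self _)
    ((G.edge_iff x hk y).1 hy)

end TurnBasedGame

/-! ### One-step operators and the decision process of a selector. -/

namespace ConcurrentGame

variable {S M : Type*} [Fintype S] [Fintype M] (G : ConcurrentGame S M)

lemma sum_succDist_mul (s : S) (p q : Dist M) (v : S → ℝ) :
    ∑ t, G.succDist s p q t * v t = G.pre v s p q := by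
  have h : ∀ t, G.succDist s p q t = ∑ a, ∑ b, p a * q b * G.trans s a b t := fun t => rfl
  simp_rw [h, Finset.sum_mul]
  unfold pre
  rw [Finset.sum_comm]
  refine Finset.sum_congr rfl fun a _ => ?_
  rw [Finset.sum_comm]
  exact Finset.sum_congr rfl fun b _ => Finset.sum_congr rfl fun t _ => by ring

/-- The infimum over selectors of player 2 is attained at a move, so only pure replies have to be
checked. -/
lemma le_preOf_iff {v : S → ℝ} {s : S} {p : Dist M} {c : ℝ} :
    c ≤ G.preOf v s p ↔ ∀ b ∈ G.mov2 s, c ≤ G.pre v s p (Dist.dirac b) := by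
  obtain ⟨b, hb, he, hle⟩ := G.exists_move_eq_preOf v s p
  exact ⟨fun h b' hb' => h.trans (hle (pureSel hb')), fun h => he ▸ h b hb⟩

lemma pre_mono {u v : S → ℝ} (h : ∀ t, u t ≤ v t) (s : S) (p q : Dist M) :
    G.pre u s p q ≤ G.pre v s p q := by
  rw [← sum_succDist_mul, ← sum_succDist_mul]
  exact Dist.sum_mul_mono _ h

lemma preOf_mono {u v : S → ℝ} (h : ∀ t, u t ≤ v t) (s : S) (p : Dist M) :
    G.preOf u s p ≤ G.preOf v s p :=
  G.le_preOf_iff.2 fun b hb => (G.le_preOf_iff.1 le_rfl b hb).trans (G.pre_mono h s p _)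

lemma preOf_le_of_le {v : S → ℝ} {c : ℝ} (h : ∀ t, v t ≤ c) (s : S) (p : Dist M) :
    G.preOf v s p ≤ c := by
  obtain ⟨b, hb⟩ := G.mov2_nonempty s
  refine (G.le_preOf_iff.1 le_rfl b hb).trans ?_
  rw [← sum_succDist_mul, ← Dist.sum_mul_const (G.succDist s p (Dist.dirac b)) c]
  exact Dist.sum_mul_mono _ h

lemma preOf_le_pre1 {v : S → ℝ} (h : ∀ t, v t ≤ 1) (s : S) (p : G.Sel1 s) :
    G.preOf v s p.1 ≤ G.pre1 v s :=
  le_ciSup (f := fun p : G.Sel1 s => G.preOf v s p.1)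
    ⟨1, by rintro _ ⟨p, rfl⟩; exact G.preOf_le_of_le h s p.1⟩ p

/-- Links the probabilities of the concurrent game to the edges of the reduction, which only record
supports. -/
lemma mem_destSet_of_succDist_pos {s t : S} {p : Dist M} {b : M}
    (h : 0 < G.succDist s p (Dist.dirac b) t) : t ∈ G.destSet s (Dist.supp p) b := by
  by_contra hne
  refine h.ne' (Finset.sum_eq_zero fun a _ => Finset.sum_eq_zero fun c _ => ?_)
  have h0 := p.2.1 a
  have h1 := (G.trans s a b).2.1 t
  by_cases hc : c = b
  · subst hc
    by_contra hprod
    refine hne (Finset.mem_biUnion.2 ⟨a, ?_, ?_⟩)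
    · refine Finset.mem_filter.2 ⟨Finset.mem_univ _, lt_of_le_of_ne h0 fun h => hprod ?_⟩
      rw [show p a = 0 from h.symm, zero_mul, zero_mul]
    · refine Finset.mem_filter.2 ⟨Finset.mem_univ _, lt_of_le_of_ne h1 fun h => hprod ?_⟩
      rw [show G.trans s a c t = 0 from h.symm, mul_zero]
  · rw [show Dist.dirac b c = 0 from Pi.single_eq_of_ne hc 1, mul_zero, zero_mul]

/-- The distributions of the successor that player 2 can choose purely against `γ`. -/
def actions (γ : G.Selector1) (s : S) : Finset (Dist S) :=
  (G.mov2 s).image fun b => G.succDist s (γ s).1 (Dist.dirac b)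

lemma actions_nonempty (γ : G.Selector1) (s : S) : (G.actions γ s).Nonempty :=
  (G.mov2_nonempty s).image _

lemma realizes_actions (γ : G.Selector1) :
    Realizes (G.actions γ) (fun (τ : G.Strategy2) n (h : History S n) =>
      G.succDist h.last (G.memoryless γ n h).1 (τ n h).1) where
  le τ n h w c hc := by
    rw [sum_succDist_mul]
    obtain ⟨b, hb, he, hle⟩ := G.exists_move_eq_preOf w h.last (G.memoryless γ n h).1
    refine le_trans ?_ (hle (τ n h))
    rw [← he, ← sum_succDist_mul]
    exact hc _ (Finset.mem_image_of_mem _ hb)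
  exists_eq a ha := by
    have : ∀ n s, ∃ b ∈ G.mov2 s, G.succDist s (γ s).1 (Dist.dirac b) = a n s :=
      fun n s => Finset.mem_image.1 (ha n s)
    choose b hb hab using this
    exact ⟨fun n h => pureSel (hb n h.last), fun n h => hab n h.last⟩

/-! ### Safety values of selectors and the two improvement steps. -/

variable {G} {F : Set S}

lemma safetyValue_nonneg (γ : G.Selector1) (s : S) : 0 ≤ G.safetyValue F γ s := by
  have := Realizes.nonempty (G.actions_nonempty γ) (G.realizes_actions γ)
  exact le_ciInf fun τ => processProb_nonneg _ _ _

lemma safetyValue_le_one (γ : G.Selector1) (s : S) : G.safetyValue F γ s ≤ 1 :=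
  Realizes.iInf_le_one (G.actions_nonempty γ) (G.realizes_actions γ) s

lemma safetyValue_eq_zero (γ : G.Selector1) {s : S} (hs : s ∉ F) : G.safetyValue F γ s = 0 :=
  Realizes.iInf_eq_zero (G.actions_nonempty γ) (G.realizes_actions γ) hs

lemma safetyValue_le_preOf (γ : G.Selector1) {s : S} (hs : s ∈ F) :
    G.safetyValue F γ s ≤ G.preOf (G.safetyValue F γ) s (γ s).1 := by
  refine G.le_preOf_iff.2 fun b hb => ?_
  rw [← sum_succDist_mul]
  exact Realizes.iInf_le_sum (G.actions_nonempty γ) (G.realizes_actions γ) s hs _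
    (Finset.mem_image_of_mem _ hb)

/-- A valuation that `γ` maintains in one step is a lower bound for the safety value of `γ`. -/
lemma le_safetyValue (γ : G.Selector1) {u : S → ℝ} (h0 : ∀ t, 0 ≤ u t) (h1 : ∀ t, u t ≤ 1)
    (hF : ∀ t ∉ F, u t = 0) (hu : ∀ s ∈ F, u s ≤ G.preOf u s (γ s).1) (s : S) :
    u s ≤ G.safetyValue F γ s := by
  refine Realizes.le_iInf (G.actions_nonempty γ) (G.realizes_actions γ) u h0 h1 hF
    (fun s hs d hd => ?_) s
  obtain ⟨b, hb, rfl⟩ := Finset.mem_image.1 hd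
  rw [sum_succDist_mul]
  exact G.le_preOf_iff.1 (hu s hs) b hb

lemma valueOf_le_one (σ : G.Strategy1) (Φ : Set (ℕ → S)) (s : S) : G.valueOf σ Φ s ≤ 1 :=
  (ciInf_le (bddBelow_processProb (fun (τ : G.Strategy2) n (h : History S n) =>
      G.succDist h.last (σ n h).1 (τ n h).1) s Φ)
    (fun _ h => pureSel (G.mov2_nonempty h.last).choose_spec)).trans (processProb_le_one _ _ _)

lemma mem_W1_of_safetyValue_eq_one {γ : G.Selector1} {s : S} (h : G.safetyValue F γ s = 1) :
    s ∈ G.W1 F := by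
  have : Nonempty G.Strategy1 := ⟨G.memoryless γ⟩
  refine le_antisymm (ciSup_le fun σ => valueOf_le_one σ _ s) ?_
  rw [← h]
  exact le_ciSup (f := fun σ => G.valueOf σ (Safe F) s)
    ⟨1, by rintro _ ⟨σ, rfl⟩; exact valueOf_le_one σ _ s⟩ (G.memoryless γ)

lemma safetyValue_eq_one_of_isAbsorbing (γ : G.Selector1) {s : S} (hs : s ∈ F)
    (h : G.IsAbsorbing s) : G.safetyValue F γ s = 1 := by
  refine le_antisymm (safetyValue_le_one γ s) ?_
  -- The indicator of `s` is maintained by every selector, since `s` is absorbing.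
  have := le_safetyValue (F := F) γ (u := fun t => if t = s then 1 else 0)
    (fun t => by split_ifs <;> norm_num) (fun t => by split_ifs <;> norm_num)
    (fun t ht => if_neg fun he : t = s => ht (he ▸ hs)) (fun t ht => ?_) s
  · simpa using this
  · refine G.le_preOf_iff.2 fun b hb => ?_
    rw [← sum_succDist_mul]
    by_cases hts : t = s
    · subst hts
      have h1 : ∀ a, (γ t).1 a * G.trans t a b t = (γ t).1 a := by
        intro a
        rcases (show 0 ≤ (γ t).1 a from (γ t).1.2.1 a).eq_or_lt with h0 | h0
        · rw [← h0, zero_mul]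
        · rw [h a ((γ t).2 a h0) b hb, mul_one]
      have h2 : G.succDist t (γ t).1 (Dist.dirac b) t = 1 := by
        change ∑ a, ∑ c, (γ t).1 a * Dist.dirac b c * G.trans t a c t = 1
        have : ∀ a, ∑ c, (γ t).1 a * Dist.dirac b c * G.trans t a c t = (γ t).1 a := by
          intro a
          refine Eq.trans ?_ ((Dist.sum_dirac_mul b fun c => (γ t).1 a * G.trans t a c t).trans
            (h1 a))
          exact Finset.sum_congr rfl fun c _ => by ring
        simp_rw [this]
        exact (γ t).1.2.2
      simp [h2]
    · simp [hts]

/-- A local step improves the safety value. -/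
lemma safetyValue_lt_of_localStep {γ γ' : G.Selector1} (h : G.LocalStep F γ γ') :
    (∀ s, G.safetyValue F γ s ≤ G.safetyValue F γ' s) ∧
      ∃ s, G.safetyValue F γ s < G.safetyValue F γ' s := by
  obtain ⟨⟨s₀, hs₀⟩, ξ, hξ, hI, hN⟩ := h
  set v := G.safetyValue F γ with hv
  set u : S → ℝ := fun s => if s ∈ G.improvable F γ then G.pre1 v s else v s with hu
  have hIF : ∀ s ∈ G.improvable F γ, s ∈ F := fun s hs =>
    by_contra fun hsF => hs.1 (Or.inr hsF)
  have hvu : ∀ s, v s ≤ u s := by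
    intro s
    simp only [hu]
    split_ifs with hs
    · exact hs.2.le
    · exact le_rfl
  have hle : ∀ s, u s ≤ G.safetyValue F γ' s := by
    refine le_safetyValue γ' (fun t => (safetyValue_nonneg γ t).trans (hvu t)) (fun t => ?_)
      (fun t ht => ?_) fun s hs => ?_
    · simp only [hu]
      split_ifs with ht
      · rw [← hξ t ht]
        exact G.preOf_le_of_le (safetyValue_le_one γ) t _
      · exact safetyValue_le_one γ t
    · simp only [hu]
      rw [if_neg fun h => ht (hIF t h)]
      exact safetyValue_eq_zero γ ht
    -- By monotonicity it suffices to bound `u s` by `preOf v`: on the improvable states this is the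
    -- optimality of `ξ`, elsewhere the old selector maintains `v`.
    · refine le_trans ?_ (G.preOf_mono hvu s _)
      simp only [hu]
      split_ifs with hsI
      · rw [hI s hsI, hξ s hsI]
      · rw [hN s hsI]
        exact safetyValue_le_preOf γ hs
  refine ⟨fun s => (hvu s).trans (hle s), s₀, lt_of_lt_of_le ?_ (hle s₀)⟩
  simp only [hu, if_pos hs₀]
  exact hs₀.2

/-- A winning pure strategy of the reduction keeps the counter-optimal play among the almost-sure
winning states. -/
lemma base_mem_W1_of_mem_destSet {v : S → ℝ} {f : (G.turnBased v).Pure1}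
    (hf : ∀ x ∈ (G.turnBased v).W1 (G.tbSafe v F),
      (G.turnBased v).valueOf ((G.turnBased v).ofPure f) (Safe (G.tbSafe v F)) x = 1)
    {s : S} (hs : TBState.base s ∈ (G.turnBased v).W1 (G.tbSafe v F)) {A B : Finset M}
    (h : (A, B) ∈ G.OptSelCount v s) (hfs : (f (.base s) rfl).1 = .pair s A B h) {b : M}
    (hb : b ∈ B) {t : S} (ht : t ∈ G.destSet s A b) :
    TBState.base t ∈ (G.turnBased v).W1 (G.tbSafe v F) := by
  have h1 := TurnBasedGame.valueOf_ofPure_player1 (hf _ hs) rfl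
  rw [hfs] at h1
  have e1 : (G.turnBased v).edge (.pair s A B h) (.rand s A b ⟨B, h, hb⟩) := ⟨rfl, rfl, hb⟩
  have e2 : (G.turnBased v).edge (.rand s A b ⟨B, h, hb⟩) (.base t) := ht
  have h2 := TurnBasedGame.valueOf_ofPure_player2 h1 rfl e1
  have h3 := TurnBasedGame.valueOf_ofPure_random h2 rfl e2
  exact TurnBasedGame.mem_W1_of_valueOf_eq_one h3

lemma mem_of_valueOf_ofPure_eq_one {v : S → ℝ} {f : (G.turnBased v).Pure1} {s : S}
    (h : (G.turnBased v).valueOf ((G.turnBased v).ofPure f) (Safe (G.tbSafe v F))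
      (.base s) = 1) : s ∈ F := by
  by_contra hsF
  have h0 : TBState.base s ∉ G.tbSafe v F := hsF
  rw [TurnBasedGame.valueOf_ofPure_eq_zero h0] at h
  exact zero_ne_one h

/-- A non-local step improves the safety value: `v + ε (1 - v)` on the almost-sure winning states of
the reduction, and `v` elsewhere, is maintained by the new selector. -/
lemma safetyValue_lt_of_nonlocalStep (habs : ∀ s ∈ G.W1 F, G.IsAbsorbing s)
    {γ γ' : G.Selector1} (h : G.NonlocalStep F γ γ') :
    (∀ s, G.safetyValue F γ s ≤ G.safetyValue F γ' s) ∧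
      ∃ s, G.safetyValue F γ s < G.safetyValue F γ' s := by
  obtain ⟨-, ⟨s₀, hs₀⟩, f, hf, hU, hN⟩ := h
  set v := G.safetyValue F γ with hv
  set Y : Set S := {s | TBState.base s ∈ (G.turnBased v).W1 (G.tbSafe v F)} with hY
  have hv0 : ∀ s, 0 ≤ v s := safetyValue_nonneg γ
  have hv1 : ∀ s, v s ≤ 1 := safetyValue_le_one γ
  have hYF : ∀ s ∈ Y, s ∈ F := fun s hs => mem_of_valueOf_ofPure_eq_one (hf _ hs)
  have hUY : ∀ s ∈ G.nonlocalSet F γ, s ∈ Y ∧ s ∉ G.W1 F := fun s hs => hs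
  have hpre : ∀ s ∈ G.nonlocalSet F γ, ∀ b ∈ G.mov2 s,
      v s ≤ G.pre1 v s ∧ G.pre1 v s ≤ G.pre v s (γ' s).1 (Dist.dirac b) := by
    intro s hs b hb
    refine ⟨(safetyValue_le_preOf γ (hYF s (hUY s hs).1)).trans (G.preOf_le_pre1 hv1 s _), ?_⟩
    rw [← show G.preOf v s (γ' s).1 = G.pre1 v s from (hU s hs).1]
    exact G.le_preOf_iff.1 le_rfl b hb
  -- `ε` lies below every positive gap between the expectation of `v` after a reply `b` and `v s`;
  -- there are finitely many pairs `(s, b)`, so all small positive `ε` qualify.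
  obtain ⟨ε, ⟨hε0, hε1⟩, hε⟩ : ∃ ε ∈ Set.Ioc (0 : ℝ) 1, ∀ s b,
      v s < G.pre v s (γ' s).1 (Dist.dirac b) →
        v s + ε ≤ G.pre v s (γ' s).1 (Dist.dirac b) := by
    have hev : ∀ᶠ ε in nhdsWithin (0 : ℝ) (Set.Ioi 0), ε ∈ Set.Ioc (0 : ℝ) 1 ∧ ∀ s b,
        v s < G.pre v s (γ' s).1 (Dist.dirac b) →
          v s + ε ≤ G.pre v s (γ' s).1 (Dist.dirac b) := by
      refine Filter.Eventually.and (Ioc_mem_nhdsGT one_pos) (Filter.eventually_all.2 fun s =>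
        Filter.eventually_all.2 fun b => ?_)
      by_cases hlt : v s < G.pre v s (γ' s).1 (Dist.dirac b)
      · filter_upwards [Ioc_mem_nhdsGT (sub_pos.2 hlt)] with ε hε _
        linarith [hε.2]
      · exact Filter.Eventually.of_forall fun _ h => absurd h hlt
    obtain ⟨ε, h1, h2⟩ := hev.exists
    exact ⟨ε, h1, h2⟩
  set u : S → ℝ := fun s => if s ∈ Y then v s + ε * (1 - v s) else v s with hu
  have hvu : ∀ s, v s ≤ u s := by
    intro s
    simp only [hu]
    split_ifs
    · nlinarith [hv1 s]
    · exact le_rfl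
  have hle : ∀ s, u s ≤ G.safetyValue F γ' s := by
    refine le_safetyValue γ' (fun t => (hv0 t).trans (hvu t)) (fun t => ?_)
      (fun t ht => ?_) fun s hs => ?_
    · simp only [hu]
      split_ifs
      · nlinarith [hv1 t]
      · exact hv1 t
    · simp only [hu]
      rw [if_neg fun h => ht (hYF t h)]
      exact safetyValue_eq_zero γ ht
    · by_cases hsU : s ∈ G.nonlocalSet F γ
      · have hsY := (hUY s hsU).1
        obtain ⟨-, hAB, hfs⟩ := hU s hsU
        refine G.le_preOf_iff.2 fun b hb => ?_
        obtain ⟨hb1, hb2⟩ := hpre s hsU b hb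
        have hus : u s = v s + ε * (1 - v s) := if_pos hsY
        -- Against a counter-optimal reply all possible successors lie in `Y`, where `u = (1 - ε) v
        -- + ε`, and this affine map commutes with the expectation.
        by_cases hbB : b ∈ G.countOpt v s (γ' s).1
        · have key : G.pre u s (γ' s).1 (Dist.dirac b) =
              (1 - ε) * G.pre v s (γ' s).1 (Dist.dirac b) + ε := by
            refine Eq.trans ?_ (congrArg ((1 - ε) * G.pre v s (γ' s).1 (Dist.dirac b) + ·)
              (Dist.sum_mul_const (G.succDist s (γ' s).1 (Dist.dirac b)) ε))
            rw [← sum_succDist_mul, ← sum_succDist_mul, Finset.mul_sum, ← Finset.sum_add_distrib]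
            refine Finset.sum_congr rfl fun t _ => ?_
            rcases (show 0 ≤ G.succDist s (γ' s).1 (Dist.dirac b) t from
              (G.succDist s (γ' s).1 (Dist.dirac b)).2.1 t).eq_or_lt with h0 | h0
            · rw [← h0]; ring
            · have htY : t ∈ Y := base_mem_W1_of_mem_destSet hf hsY hAB hfs hbB
                (G.mem_destSet_of_succDist_pos h0)
              simp only [hu, if_pos htY]
              ring
          rw [key, hus]
          nlinarith
        -- A reply that is not counter-optimal exceeds `pre1 v s ≥ v s` strictly, hence by a gap of
        -- at least `ε ≥ ε (1 - v s)`.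
        · refine le_trans ?_ (G.pre_mono hvu s _ _)
          have hne : G.pre v s (γ' s).1 (Dist.dirac b) ≠ G.pre1 v s := fun he =>
            hbB (Finset.mem_filter.2 ⟨hb, he⟩)
          have := hε s b (hb1.trans_lt (lt_of_le_of_ne hb2 hne.symm))
          rw [hus]
          nlinarith [hv0 s]
      -- Where the selector is unchanged, `u s = v s`: either `s ∉ Y`, or `s` is in `W1` and
      -- absorbing, so `v s = 1`.
      · refine le_trans ?_ (G.preOf_mono hvu s _)
        rw [hN s hsU]
        refine le_trans (le_of_eq ?_) (safetyValue_le_preOf γ hs)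
        simp only [hu]
        split_ifs with hsY
        · have hsW : s ∈ G.W1 F := by_contra fun h => hsU ⟨hsY, h⟩
          have h1 : v s = 1 := safetyValue_eq_one_of_isAbsorbing γ hs (habs s hsW)
          change _ = v s
          rw [h1]
          ring
        · rfl
  refine ⟨fun s => (hvu s).trans (hle s), s₀, lt_of_lt_of_le ?_ (hle s₀)⟩
  -- Strictness: `v s₀ = 1` would put `s₀` in `W1`, so the increment `ε (1 - v s₀)` is positive.
  have hlt : v s₀ < 1 := lt_of_le_of_ne (hv1 s₀) fun h =>
    (hUY s₀ hs₀).2 (mem_W1_of_safetyValue_eq_one h)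
  simp only [hu, if_pos (hUY s₀ hs₀).1]
  nlinarith

end ConcurrentGame

end CSG

end

theorem theorem6 {S M : Type*} [Fintype S] [Fintype M] (G : CSG.ConcurrentGame S M) (F : Set S)
    (habs : ∀ s, s ∈ G.W1 F ∪ Fᶜ → G.IsAbsorbing s)
    (γ : ℕ → G.Selector1) (n : ℕ) (hrun : G.IsRun F γ n)
    (i : ℕ) (hi : i < n) (hne : γ i ≠ γ (i + 1)) :
    (∀ s, G.valueOf (G.memoryless (γ i)) (CSG.Safe F) s ≤
      G.valueOf (G.memoryless (γ (i + 1))) (CSG.Safe F) s) ∧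
    ∃ s, G.valueOf (G.memoryless (γ i)) (CSG.Safe F) s <
      G.valueOf (G.memoryless (γ (i + 1))) (CSG.Safe F) s := by
  rcases hrun.pass i hi with h | h | h
  · exact CSG.ConcurrentGame.safetyValue_lt_of_localStep h
  · exact CSG.ConcurrentGame.safetyValue_lt_of_nonlocalStep (fun s hs => habs s (Or.inl hs)) h
  · exact absurd h.2.symm hne
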